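/- Let $r\ge 1$ and let $\boldsymbol{k}=(k_1,\ldots,k_r)$ be an admissible index, that is, $k_1,\ldots,k_r$ are positive integers and $k_r\ge 2$. For $s\in\mathbb{C}$ consider the Ohno series \[ I_{\boldsymbol{k}}(s)=\sum_{i=1}^{r}\ \sum_{0<n_1<\cdots<n_r}\frac{1}{n_1^{k_1}\cdots n_r^{k_r}}\cdot\frac{1}{n_i^{s}}\prod_{j\ne i}\frac{n_j}{n_j-n_i}, \] where $n_1,\ldots,n_r$ run over integers. This series converges absolutely, in the sense that \[ \sum_{i=1}^{r}\ \sum_{0<n_1<\cdots<n_r}\left|\frac{1}{n_1^{k_1}\cdots n_r^{k_r}}\cdot\frac{1}{n_i^{s}}\prod_{j\ne i}\frac{n_j}{n_j-n_i}\right|<\infty, \] if and only if \[ \operatorname{Re}(s)>\max_{1\le j\le r}\{\,r-2j+2-(k_j+\cdots+k_r)\,\}. \] -/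

import Mathlib

/-- An index `k = (k_1, …, k_r)` of depth `r ≥ 1` is admissible if all its entries are positive
integers and its last entry is at least `2`. Position `j : Fin r` stands for the subscript
`j + 1`. -/
def OhnoAdmissible {r : ℕ} [NeZero r] (k : Fin r → ℕ) : Prop :=
  (∀ j, 1 ≤ k j) ∧ 2 ≤ k ⟨r - 1, Nat.sub_one_lt (NeZero.ne r)⟩

/-- The tuples `0 < n_1 < ⋯ < n_r` of natural numbers. -/
def OhnoTuple (r : ℕ) : Type :=
  {n : Fin r → ℕ // (∀ j, 0 < n j) ∧ StrictMono n}

/-- The summand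
`1 / (n_1 ^ k_1 ⋯ n_r ^ k_r) * (1 / n_i ^ s) * ∏_{j ≠ i} n_j / (n_j - n_i)`
of the Ohno series. -/
noncomputable def ohnoTerm {r : ℕ} (k : Fin r → ℕ) (s : ℂ) (i : Fin r) (n : OhnoTuple r) : ℂ :=
  1 / (∏ j, (n.1 j : ℂ) ^ k j) * (1 / (n.1 i : ℂ) ^ s) *
    ∏ j ∈ Finset.univ.erase i, (n.1 j : ℂ) / ((n.1 j : ℂ) - (n.1 i : ℂ))

/-- The Ohno series `∑_i ∑_{0 < n_1 < ⋯ < n_r}` converges absolutely: the sum of the absolute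
values of all its terms, over `i` and over the tuples `n`, is finite. -/
def OhnoAbsConverges {r : ℕ} (k : Fin r → ℕ) (s : ℂ) : Prop :=
  Summable fun p : Fin r × OhnoTuple r => ‖ohnoTerm k s p.1 p.2‖

/-- `max_{1 ≤ j ≤ r} (r - 2 j + 2 - (k_j + ⋯ + k_r))`, the subscript `j` being the position
`j : Fin r` plus one. -/
noncomputable def ohnoAbscissa {r : ℕ} [NeZero r] (k : Fin r → ℕ) : ℝ :=
  Finset.univ.sup' Finset.univ_nonempty fun j : Fin r =>
    (r : ℝ) - 2 * ((j : ℕ) + 1 : ℝ) + 2 - ∑ l ∈ Finset.Ici j, (k l : ℝ)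

/-! Sufficiency: the kernel takes the factors `1 / |n_l - n_i|`, with one extra `1 / n_l` when `l <
i`, where partial fractions also save a power of `n_i`. The kernel has uniformly bounded sums, so
times `n_i ^ (-(1 + ε))` it is summable. What remains is a monomial `∏ n_l ^ c_l` on increasing
tuples, at most `1` by Abel summation if all suffix sums of `c` are nonpositive. Suffixes starting
at `m ≤ i` give the abscissa condition at `m`; later ones follow from admissibility
(`norm_ohnoTerm_le`). Necessity: take `i` last. For each `j`, freeze the entries before `j` and let
the others have size about `M`, the last one being fixed by `M`. Counting these tuples bounds the
series below by a multiple of `∑ (M + 1) ^ a`, and `a < -1` is the inequality at `j`. -/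

/-- Abel summation: a linear form whose suffix sums are nonpositive is nonpositive on monotone
nonnegative vectors. -/
theorem sum_mul_nonpos_of_suffix_sums_nonpos {r : ℕ} (c x : Fin r → ℝ) (hx : Monotone x)
    (hx0 : ∀ l, 0 ≤ x l) (hc : ∀ m, ∑ l, (if m ≤ l then c l else 0) ≤ 0) :
    ∑ l, c l * x l ≤ 0 := by
  induction r with
  | zero => simp
  | succ r ih =>
    have h0 : ∑ l, c l ≤ 0 := by simpa using hc 0
    -- Subtracting `x 0` leaves a monotone nonnegative tail; `x 0` itself multiplies the full sum of
    -- `c`.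
    have h := ih (fun l => c l.succ) (fun l => x l.succ - x 0)
      (fun a b hab => by
        have := hx (Fin.succ_le_succ_iff.2 hab)
        simpa using this)
      (fun l => sub_nonneg.2 (hx (Fin.zero_le _)))
      (fun m => by
        have := hc m.succ
        rw [Fin.sum_univ_succ] at this
        simpa using this)
    have e : ∑ l, c l * x l = x 0 * ∑ l, c l + ∑ l : Fin r, c l.succ * (x l.succ - x 0) := by
      rw [Fin.sum_univ_succ, Fin.sum_univ_succ, mul_add, Finset.mul_sum, add_assoc,
        ← Finset.sum_add_distrib]
      congr 1
      · ring
      · exact Finset.sum_congr rfl fun l _ => by ring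
    rw [e]
    nlinarith [hx0 0]

theorem prod_rpow_le_one_of_suffix_sums_nonpos {r : ℕ} (c x : Fin r → ℝ) (hx : Monotone x)
    (hx1 : ∀ l, 1 ≤ x l) (hc : ∀ m, ∑ l, (if m ≤ l then c l else 0) ≤ 0) :
    ∏ l, x l ^ c l ≤ 1 := by
  have hpos : ∀ l, 0 < x l := fun l => one_pos.trans_le (hx1 l)
  have h := sum_mul_nonpos_of_suffix_sums_nonpos c (fun l => Real.log (x l))
    (fun a b hab => Real.log_le_log (hpos a) (hx hab)) (fun l => Real.log_nonneg (hx1 l)) hc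
  calc ∏ l, x l ^ c l = Real.exp (∑ l, c l * Real.log (x l)) := by
        rw [Real.exp_sum]
        exact Finset.prod_congr rfl fun l _ => by rw [Real.rpow_def_of_pos (hpos l), mul_comm]
    _ ≤ 1 := Real.exp_le_one_iff.2 h

/-- A product over the coordinates of a tuple is summable if one factor is summable and the others
have partial sums bounded uniformly in that coordinate. -/
theorem summable_mul_prod_erase {ι : Type*} [Fintype ι] [DecidableEq ι] (i : ι) {F : ℕ → ℝ}
    {g : ℕ → ℕ → ℝ} {C : ℝ} (hF : Summable F) (hF0 : ∀ N, 0 ≤ F N) (hg0 : ∀ N x, 0 ≤ g N x)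
    (hg : ∀ N (S : Finset ℕ), ∑ x ∈ S, g N x ≤ C) :
    Summable fun p : ι → ℕ => F (p i) * ∏ l ∈ Finset.univ.erase i, g (p i) (p l) := by
  -- A delta at `p i = N` decouples the coordinates, so the sum over a box factors for each fixed
  -- `N`.
  set f : ℕ → ι → ℕ → ℝ := fun N l x => if l = i then (if x = N then F N else 0) else g N x with hf
  have hf0 : ∀ N l x, 0 ≤ f N l x := by
    intro N l x
    simp only [hf]
    split_ifs
    exacts [hF0 N, le_rfl, hg0 N x]
  have hC : 0 ≤ C := by simpa using hg 0 ∅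
  refine summable_of_sum_le (c := (∑' N, F N) * C ^ (Finset.univ.erase i).card)
    (fun p => mul_nonneg (hF0 _) (Finset.prod_nonneg fun l _ => hg0 _ _)) fun u => ?_
  set S : Finset ℕ := u.biUnion fun p => Finset.univ.image p with hS
  have huS : u ⊆ Fintype.piFinset fun _ : ι => S := fun p hp => by
    rw [Fintype.mem_piFinset]
    exact fun l => Finset.mem_biUnion.2 ⟨p, hp, Finset.mem_image_of_mem _ (Finset.mem_univ l)⟩
  calc ∑ p ∈ u, F (p i) * ∏ l ∈ Finset.univ.erase i, g (p i) (p l)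
      ≤ ∑ p ∈ Fintype.piFinset fun _ : ι => S, ∑ N ∈ S, ∏ l, f N l (p l) := by
        refine (Finset.sum_le_sum fun p hp => ?_).trans
          (Finset.sum_le_sum_of_subset_of_nonneg huS fun p _ _ =>
            Finset.sum_nonneg fun N _ => Finset.prod_nonneg fun l _ => hf0 _ _ _)
        have hpi : p i ∈ S := Fintype.mem_piFinset.1 (huS hp) i
        refine le_trans (le_of_eq ?_) (Finset.single_le_sum
          (f := fun N => ∏ l, f N l (p l))
          (fun N _ => Finset.prod_nonneg fun l _ => hf0 _ _ _) hpi)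
        rw [← Finset.mul_prod_erase _ _ (Finset.mem_univ i)]
        congr 1
        · simp [hf]
        · refine Finset.prod_congr rfl fun l hl => ?_
          simp [hf, Finset.ne_of_mem_erase hl]
    _ = ∑ N ∈ S, ∏ l, ∑ x ∈ S, f N l x := by
        rw [Finset.sum_comm]
        exact Finset.sum_congr rfl fun N _ => (Finset.prod_univ_sum _ _).symm
    _ ≤ ∑ N ∈ S, F N * C ^ (Finset.univ.erase i).card := by
        refine Finset.sum_le_sum fun N hN => ?_
        rw [← Finset.mul_prod_erase _ _ (Finset.mem_univ i)]
        refine mul_le_mul (le_of_eq (by simp [hf, hN])) ?_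
          (Finset.prod_nonneg fun l _ => Finset.sum_nonneg fun x _ => hf0 _ _ _) (hF0 N)
        rw [← Finset.prod_const]
        refine Finset.prod_le_prod (fun l _ => Finset.sum_nonneg fun x _ => hf0 _ _ _)
          fun l hl => ?_
        simpa [hf, Finset.ne_of_mem_erase hl] using hg N S
    _ ≤ (∑' N, F N) * C ^ (Finset.univ.erase i).card := by
        rw [← Finset.sum_mul]
        exact mul_le_mul_of_nonneg_right (hF.sum_le_tsum _ fun N _ => hF0 N) (pow_nonneg hC _)

/-! ### Kernel estimates -/

/-- A kernel dominating both `1 / (n (N - n))` and `1 / (n - N)` up to small powers. -/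
noncomputable def ohnoKernel (ε : ℝ) (N x : ℕ) : ℝ :=
  (x : ℝ) ^ (-(1 + ε)) + |(x : ℝ) - N| ^ (-(1 + ε))

theorem ohnoKernel_nonneg (ε : ℝ) (N x : ℕ) : 0 ≤ ohnoKernel ε N x := by
  unfold ohnoKernel; positivity

/-- Both parts are translates of one series over `ℤ`; the poles are harmless because `0 ^ (-(1 + ε))
= 0` for real powers. -/
theorem sum_ohnoKernel_le {ε : ℝ} (hε : 0 < ε) (N : ℕ) (S : Finset ℕ) :
    ∑ x ∈ S, ohnoKernel ε N x ≤ 2 * ∑' z : ℤ, |(z : ℝ)| ^ (-(1 + ε)) := by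
  have hs : Summable fun z : ℤ => |(z : ℝ)| ^ (-(1 + ε)) :=
    Real.summable_abs_int_rpow (by linarith)
  have key : ∀ a : ℤ, ∑ x ∈ S, |((x - a : ℤ) : ℝ)| ^ (-(1 + ε)) ≤
      ∑' z : ℤ, |(z : ℝ)| ^ (-(1 + ε)) := fun a => by
    have := hs.sum_le_tsum (S.map ⟨fun x : ℕ => (x : ℤ) - a, fun x y h => by simpa using h⟩)
      fun z _ => by positivity
    rw [Finset.sum_map] at this
    exact this
  have h0 := key 0
  have hN := key N
  simp only [ohnoKernel, Finset.sum_add_distrib]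
  push_cast at h0 hN
  simp only [sub_zero, Nat.abs_cast] at h0
  linarith

/-- Partial fractions: `1 / (x (N - x)) = (1 / N) (1 / x + 1 / (N - x))`, and both `x` and `N - x`
are at most `N`. -/
theorem inv_mul_inv_sub_le {ε : ℝ} (hε : 0 < ε) {N x : ℕ} (hx : 0 < x) (hxN : x < N) :
    (x : ℝ)⁻¹ * |(x : ℝ) - N|⁻¹ ≤ (N : ℝ) ^ (-1 + ε) * ohnoKernel ε N x := by
  have hx' : (0 : ℝ) < x := by exact_mod_cast hx
  have hd : (0 : ℝ) < N - x := sub_pos.2 (by exact_mod_cast hxN)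
  have hN : (0 : ℝ) < N := by linarith
  have key : ∀ y : ℝ, 0 < y → y ≤ N → y⁻¹ ≤ (N : ℝ) ^ ε * y ^ (-(1 + ε)) := fun y hy hyN => by
    have : y⁻¹ = y ^ ε * y ^ (-(1 + ε)) := by
      rw [← Real.rpow_add hy, ← Real.rpow_neg_one]; congr 1; ring
    rw [this]
    gcongr
  rw [ohnoKernel, abs_sub_comm, abs_of_pos hd, Real.rpow_add hN, Real.rpow_neg_one]
  have h1 := key x hx' (by linarith)
  have h2 := key (N - x) hd (by linarith)
  calc (x : ℝ)⁻¹ * ((N : ℝ) - x)⁻¹ = (N : ℝ)⁻¹ * ((x : ℝ)⁻¹ + ((N : ℝ) - x)⁻¹) := by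
        field_simp; ring
    _ ≤ (N : ℝ)⁻¹ * ((N : ℝ) ^ ε * (x : ℝ) ^ (-(1 + ε)) +
          (N : ℝ) ^ ε * ((N : ℝ) - x) ^ (-(1 + ε))) := by gcongr
    _ = _ := by ring

theorem inv_sub_le {ε : ℝ} (hε : 0 < ε) {N x : ℕ} (hxN : N < x) :
    |(x : ℝ) - N|⁻¹ ≤ (x : ℝ) ^ ε * ohnoKernel ε N x := by
  have hd : (0 : ℝ) < x - N := sub_pos.2 (by exact_mod_cast hxN)
  have hN : (0 : ℝ) ≤ N := by positivity
  rw [ohnoKernel, abs_of_pos hd]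
  calc ((x : ℝ) - N)⁻¹ = ((x : ℝ) - N) ^ ε * ((x : ℝ) - N) ^ (-(1 + ε)) := by
        rw [← Real.rpow_add hd, ← Real.rpow_neg_one]; congr 1; ring
    _ ≤ (x : ℝ) ^ ε * ((x : ℝ) - N) ^ (-(1 + ε)) := by gcongr; linarith
    _ ≤ _ := by
        gcongr
        exact le_add_of_nonneg_left (by positivity)

/-! ### Size of the summand and sufficiency -/

theorem norm_ohnoTerm {r : ℕ} (k : Fin r → ℕ) (s : ℂ) (i : Fin r) (n : OhnoTuple r) :
    ‖ohnoTerm k s i n‖ = (n.1 i : ℝ) ^ (-(k i : ℝ) - s.re) *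
      ∏ l ∈ Finset.univ.erase i,
        (n.1 l : ℝ) ^ (1 - (k l : ℝ)) * |(n.1 l : ℝ) - n.1 i|⁻¹ := by
  have hpos : ∀ l, (0 : ℝ) < n.1 l := fun l => by exact_mod_cast n.2.1 l
  have hd : ∀ l, ‖(n.1 l : ℂ) - (n.1 i : ℂ)‖ = |(n.1 l : ℝ) - n.1 i| := fun l => by
    rw [← Complex.ofReal_natCast, ← Complex.ofReal_natCast, ← Complex.ofReal_sub,
      Complex.norm_real, Real.norm_eq_abs]
  rw [ohnoTerm, norm_mul, norm_mul, norm_div, norm_div, norm_one, norm_prod, norm_prod,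
    Complex.norm_natCast_cpow_of_pos (n.2.1 i)]
  simp only [norm_div, norm_pow, Complex.norm_natCast, hd]
  rw [← Finset.mul_prod_erase _ _ (Finset.mem_univ i), one_div, mul_inv, ← Finset.prod_inv_distrib,
    mul_right_comm _ (∏ _ ∈ _, _), mul_assoc (_ * _), ← Finset.prod_mul_distrib, one_div]
  congr 1
  · rw [sub_eq_add_neg, Real.rpow_add (hpos i), Real.rpow_neg (hpos i).le, Real.rpow_natCast,
      Real.rpow_neg (hpos i).le]
  · refine Finset.prod_congr rfl fun l _ => ?_
    rw [Real.rpow_sub (hpos l), Real.rpow_one, Real.rpow_natCast]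
    ring

/-- The exponents left over once the summable majorant is split off. -/
noncomputable def ohnoExponent {r : ℕ} (k : Fin r → ℕ) (σ ε : ℝ) (i l : Fin r) : ℝ :=
  if l < i then 2 - k l else if l = i then -k i - σ + 1 + ε + (i : ℕ) * (-1 + ε)
    else 1 - k l + ε

theorem suffix_sums_ohnoExponent_nonpos {r : ℕ} [NeZero r] {k : Fin r → ℕ} (hk : OhnoAdmissible k)
    {σ ε : ℝ} (hε : 0 < ε) (hr : r * ε ≤ 1) (hσ : ohnoAbscissa k + r * ε ≤ σ) (i m : Fin r) :
    ∑ l, (if m ≤ l then ohnoExponent k σ ε i l else 0) ≤ 0 := by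
  obtain hm | hm := le_or_gt m i
  -- For `m ≤ i` the suffix sum is exactly the abscissa entry at `m`, plus `r * ε - σ`.
  · have h1 : (r : ℝ) - 2 * ((m : ℕ) + 1 : ℝ) + 2 - ∑ l ∈ Finset.Ici m, (k l : ℝ) ≤
        ohnoAbscissa k :=
      Finset.le_sup' (fun j : Fin r =>
        (r : ℝ) - 2 * ((j : ℕ) + 1 : ℝ) + 2 - ∑ l ∈ Finset.Ici j, (k l : ℝ)) (Finset.mem_univ m)
    have e : ∀ l, (if m ≤ l then ohnoExponent k σ ε i l else 0) =
        -(if l ∈ Finset.Ici m then (k l : ℝ) else 0) + (if l ∈ Finset.Ico m i then 2 else 0) +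
          (if l ∈ Finset.Ioi i then 1 + ε else 0) +
          (if l = i then 1 - σ + ε + (i : ℕ) * (-1 + ε) else 0) := fun l => by
      simp only [ohnoExponent, Finset.mem_Ici, Finset.mem_Ico, Finset.mem_Ioi]
      obtain h | h | h := lt_trichotomy l i
      · by_cases hml : m ≤ l
        · simp [h, hml, h.not_gt, h.ne]; ring
        · simp [hml, h.not_gt, h.ne]
      · subst h
        simp [hm]; ring
      · simp [h, h.not_gt, h.ne', hm.trans h.le]; ring
    have hi : (i : ℕ) + 1 ≤ r := i.2
    rw [Finset.sum_congr rfl fun l _ => e l]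
    simp only [Finset.sum_add_distrib, Finset.sum_neg_distrib, Finset.sum_ite_mem,
      Finset.univ_inter, Finset.sum_const, Fin.card_Ico, Fin.card_Ioi, nsmul_eq_mul,
      Finset.sum_ite_eq', Finset.mem_univ, if_true]
    rw [Nat.cast_sub (Fin.le_def.1 hm), show r - 1 - (i : ℕ) = r - (i + 1) by omega,
      Nat.cast_sub hi]
    push_cast
    linarith
  -- Beyond `i` each exponent is at most `ε`, and `k_r ≥ 2` gains `1` at the last position.
  · calc ∑ l, (if m ≤ l then ohnoExponent k σ ε i l else 0)
        ≤ ∑ l, (ε - if l = (⟨r - 1, Nat.sub_one_lt (NeZero.ne r)⟩ : Fin r) then 1 else 0) := by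
          refine Finset.sum_le_sum fun l _ => ?_
          have h1 : (1 : ℝ) ≤ k l := by exact_mod_cast hk.1 l
          by_cases hml : m ≤ l
          · have hil := hm.trans_le hml
            simp only [hml, if_true, ohnoExponent, hil.not_gt, hil.ne', if_false]
            split_ifs with h
            · have : (2 : ℝ) ≤ k l := by rw [h]; exact_mod_cast hk.2
              linarith
            · linarith
          · have : l ≠ ⟨r - 1, Nat.sub_one_lt (NeZero.ne r)⟩ := fun h => hml <| by
              rw [h, Fin.le_def]
              have := m.2
              simp only; omega
            simp [hml, this, hε.le]
      _ ≤ 0 := by simpa using hr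

theorem norm_ohnoTerm_le {r : ℕ} [NeZero r] {k : Fin r → ℕ} (hk : OhnoAdmissible k) {s : ℂ} {ε : ℝ}
    (hε : 0 < ε) (hr : r * ε ≤ 1) (hs : ohnoAbscissa k + r * ε ≤ s.re) (i : Fin r)
    (n : OhnoTuple r) :
    ‖ohnoTerm k s i n‖ ≤ (n.1 i : ℝ) ^ (-(1 + ε)) *
      ∏ l ∈ Finset.univ.erase i, ohnoKernel ε (n.1 i) (n.1 l) := by
  have hpos : ∀ l, (0 : ℝ) < n.1 l := fun l => by exact_mod_cast n.2.1 l
  set c := ohnoExponent k s.re ε i with hc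
  have hfac : ∀ l ∈ Finset.univ.erase i,
      (n.1 l : ℝ) ^ (1 - (k l : ℝ)) * |(n.1 l : ℝ) - n.1 i|⁻¹ ≤
        (if l < i then (n.1 i : ℝ) ^ (-1 + ε) else 1) *
          ((n.1 l : ℝ) ^ c l * ohnoKernel ε (n.1 i) (n.1 l)) := fun l hl => by
    obtain h | h := lt_or_gt_of_ne (Finset.ne_of_mem_erase hl)
    · have h2 := inv_mul_inv_sub_le hε (n.2.1 l) (n.2.2 h)
      have : (n.1 l : ℝ) ^ (1 - (k l : ℝ)) = (n.1 l : ℝ) ^ c l * (n.1 l : ℝ)⁻¹ := by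
        rw [← Real.rpow_neg_one, ← Real.rpow_add (hpos l)]
        simp only [hc, ohnoExponent, h, if_true]
        congr 1; ring
      rw [this, if_pos h, mul_assoc, mul_left_comm ((n.1 i : ℝ) ^ (-1 + ε))]
      exact mul_le_mul_of_nonneg_left h2 (by positivity)
    · have h2 := inv_sub_le hε (n.2.2 h)
      have : (n.1 l : ℝ) ^ c l = (n.1 l : ℝ) ^ (1 - (k l : ℝ)) * (n.1 l : ℝ) ^ ε := by
        rw [← Real.rpow_add (hpos l)]
        simp [hc, ohnoExponent, h.not_gt, h.ne']
      rw [this, if_neg h.not_gt, one_mul, mul_assoc]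
      exact mul_le_mul_of_nonneg_left h2 (by positivity)
  have hcount : ∏ l ∈ Finset.univ.erase i, (if l < i then (n.1 i : ℝ) ^ (-1 + ε) else 1) =
      (n.1 i : ℝ) ^ ((i : ℕ) * (-1 + ε)) := by
    rw [← Finset.prod_filter, Finset.prod_const, mul_comm, Real.rpow_mul_natCast (hpos i).le]
    congr 1
    rw [← Fin.card_Iio i]
    congr 1
    ext l
    simp only [Finset.mem_filter, Finset.mem_erase, Finset.mem_univ, and_true, Finset.mem_Iio]
    exact ⟨fun h => h.2, fun h => ⟨h.ne, h⟩⟩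
  have habel : ∏ l, (n.1 l : ℝ) ^ c l ≤ 1 :=
    prod_rpow_le_one_of_suffix_sums_nonpos c (fun l => (n.1 l : ℝ))
      (fun a b hab => Nat.cast_le.2 (n.2.2.monotone hab))
      (fun l => by exact_mod_cast n.2.1 l)
      (suffix_sums_ohnoExponent_nonpos hk hε hr hs i)
  have hci : (n.1 i : ℝ) ^ (-(k i : ℝ) - s.re) * (n.1 i : ℝ) ^ ((i : ℕ) * (-1 + ε)) =
      (n.1 i : ℝ) ^ c i * (n.1 i : ℝ) ^ (-(1 + ε)) := by
    rw [← Real.rpow_add (hpos i), ← Real.rpow_add (hpos i)]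
    simp only [hc, ohnoExponent, lt_irrefl, if_true, if_false]
    congr 1; ring
  have hK : 0 ≤ (n.1 i : ℝ) ^ (-(1 + ε)) *
      ∏ l ∈ Finset.univ.erase i, ohnoKernel ε (n.1 i) (n.1 l) :=
    mul_nonneg (by positivity) (Finset.prod_nonneg fun l _ => ohnoKernel_nonneg _ _ _)
  rw [norm_ohnoTerm]
  calc _ ≤ (n.1 i : ℝ) ^ (-(k i : ℝ) - s.re) * ∏ l ∈ Finset.univ.erase i,
        (if l < i then (n.1 i : ℝ) ^ (-1 + ε) else 1) *
          ((n.1 l : ℝ) ^ c l * ohnoKernel ε (n.1 i) (n.1 l)) :=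
        mul_le_mul_of_nonneg_left (Finset.prod_le_prod (fun l _ => by positivity) hfac)
          (by positivity)
    _ = (∏ l, (n.1 l : ℝ) ^ c l) * ((n.1 i : ℝ) ^ (-(1 + ε)) *
          ∏ l ∈ Finset.univ.erase i, ohnoKernel ε (n.1 i) (n.1 l)) := by
        rw [Finset.prod_mul_distrib, Finset.prod_mul_distrib, hcount, ← mul_assoc, hci,
          ← Finset.mul_prod_erase _ (fun l => (n.1 l : ℝ) ^ c l) (Finset.mem_univ i)]
        ring
    _ ≤ _ := mul_le_of_le_one_left hK habel

theorem ohnoAbsConverges_of_abscissa_lt {r : ℕ} [NeZero r] {k : Fin r → ℕ} (hk : OhnoAdmissible k)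
    {s : ℂ} (hs : ohnoAbscissa k < s.re) : OhnoAbsConverges k s := by
  have hr : (0 : ℝ) < r := by exact_mod_cast NeZero.pos r
  have hδ : 0 < min 1 (s.re - ohnoAbscissa k) := lt_min one_pos (sub_pos.2 hs)
  set ε := min 1 (s.re - ohnoAbscissa k) / r with hε
  have hε0 : 0 < ε := div_pos hδ hr
  have hrε : r * ε = min 1 (s.re - ohnoAbscissa k) := by rw [hε]; field_simp
  have h1 : r * ε ≤ 1 := hrε.trans_le (min_le_left _ _)
  have h2 : ohnoAbscissa k + r * ε ≤ s.re := by
    have := min_le_right 1 (s.re - ohnoAbscissa k)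
    linarith
  rw [OhnoAbsConverges, summable_prod_of_nonneg fun _ => norm_nonneg _]
  refine ⟨fun i => ?_, Summable.of_finite⟩
  have hsum := summable_mul_prod_erase (ι := Fin r) i (g := ohnoKernel ε)
    (Real.summable_nat_rpow.2 (by linarith : -(1 + ε) < -1)) (fun N => by positivity)
    (ohnoKernel_nonneg ε) (sum_ohnoKernel_le hε0)
  exact Summable.of_nonneg_of_le (fun _ => norm_nonneg _)
    (fun n => norm_ohnoTerm_le hk hε0 h1 h2 i n)
    (hsum.comp_injective (i := fun n : OhnoTuple r => n.1) Subtype.val_injective)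

/-! ### Necessity -/

/-- The last position of an index of positive depth. -/
abbrev ohnoLast (r : ℕ) [NeZero r] : Fin r := ⟨r - 1, Nat.sub_one_lt (NeZero.ne r)⟩

/-- A family of tuples whose entries before position `j` are `1, 2, …`, and whose entries from `j`
on lie in consecutive blocks of length `M + 1`. -/
def ohnoPoint {r : ℕ} [NeZero r] (j : Fin r) (M : ℕ)
    (t : {l : Fin r // j ≤ l ∧ l < ohnoLast r} → Fin (M + 1)) (l : Fin r) : ℕ :=
  if l < j then l + 1
  else (M + 1) * (l + 1) + if h : j ≤ l ∧ l < ohnoLast r then (t ⟨l, h⟩ : ℕ) else 0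

section

variable {r : ℕ} [NeZero r] (j : Fin r) (M : ℕ)
  (t : {l : Fin r // j ≤ l ∧ l < ohnoLast r} → Fin (M + 1))

theorem ohnoPoint_last : ohnoPoint j M t (ohnoLast r) = (M + 1) * r := by
  have h : ¬ ohnoLast r < j := fun h => by
    have := j.2
    rw [Fin.lt_def] at h
    simp only at h; omega
  have hr := NeZero.pos r
  rw [ohnoPoint, if_neg h, dif_neg fun h => h.2.false, add_zero]
  congr 1
  simp only; omega

theorem ohnoPoint_pos (l : Fin r) : 0 < ohnoPoint j M t l := by
  unfold ohnoPoint
  split_ifs <;> positivity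

theorem ohnoPoint_lt (l : Fin r) : ohnoPoint j M t l < (M + 1) * (l + 2) := by
  unfold ohnoPoint
  split_ifs with h h'
  · nlinarith
  · have := (t ⟨l, h'⟩).2
    nlinarith
  · nlinarith

theorem strictMono_ohnoPoint : StrictMono (ohnoPoint j M t) := fun a b hab => by
  have hab' : (a : ℕ) + 1 ≤ b := hab
  by_cases hb : b < j
  · simp only [ohnoPoint, hb, hab.trans hb, if_true]; omega
  · refine (ohnoPoint_lt j M t a).trans_le ?_
    rw [ohnoPoint, if_neg hb]
    nlinarith

/-- The tuple of block type as an element of the index set of the Ohno series. -/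
def ohnoBlockTuple : OhnoTuple r :=
  ⟨ohnoPoint j M t, ohnoPoint_pos j M t, strictMono_ohnoPoint j M t⟩

end

theorem ohnoBlockTuple_injective {r : ℕ} [NeZero r] (j : Fin r) :
    Function.Injective fun x : (Σ M : ℕ, {l : Fin r // j ≤ l ∧ l < ohnoLast r} → Fin (M + 1)) =>
      ohnoBlockTuple j x.1 x.2 := by
  rintro ⟨M, t⟩ ⟨M', t'⟩ h
  have h' : ∀ l, ohnoPoint j M t l = ohnoPoint j M' t' l :=
    fun l => congrFun (congrArg Subtype.val h) l
  obtain rfl : M = M' := by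
    have := h' (ohnoLast r)
    rw [ohnoPoint_last, ohnoPoint_last] at this
    have := Nat.eq_of_mul_eq_mul_right (NeZero.pos r) this
    omega
  congr 1
  funext l
  have := h' l
  simp only [ohnoPoint, if_neg l.2.1.not_gt, dif_pos l.2] at this
  exact Fin.ext (Nat.add_left_cancel this)

/-- With `N` the last entry, `N - n_l ≤ N`, and `n_l ^ (1 - k_l) ≥ N ^ (1 - k_l)` since `k_l ≥ 1`;
before `j` the entries are constants. -/
theorem exists_le_norm_ohnoTerm {r : ℕ} [NeZero r] {k : Fin r → ℕ} (hk : ∀ l, 1 ≤ k l) (s : ℂ)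
    (j : Fin r) : ∃ c : ℝ, 0 < c ∧ ∀ M t, c * (((M + 1 : ℕ) : ℝ) ^
      (-s.re - (j : ℕ) - ∑ l ∈ Finset.Ici j, (k l : ℝ))) ≤
        ‖ohnoTerm k s (ohnoLast r) (ohnoBlockTuple j M t)‖ := by
  have hr : (0 : ℝ) < r := by exact_mod_cast NeZero.pos r
  set e := -s.re - (j : ℕ) - ∑ l ∈ Finset.Ici j, (k l : ℝ) with he
  refine ⟨(∏ l ∈ Finset.univ.erase (ohnoLast r),
    if l < j then ((l : ℕ) + 1 : ℝ) ^ (1 - (k l : ℝ)) else 1) * (r : ℝ) ^ e,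
    mul_pos (Finset.prod_pos fun l _ => by split_ifs <;> positivity) (by positivity),
    fun M t => ?_⟩
  have hlast : (ohnoBlockTuple j M t).1 (ohnoLast r) = (M + 1) * r := ohnoPoint_last j M t
  set n := ohnoBlockTuple j M t with hn
  set N : ℝ := (((M + 1) * r : ℕ) : ℝ) with hN
  have hN0 : 0 < N := by
    rw [hN]; push_cast; positivity
  have hj : j ≤ ohnoLast r := Fin.le_def.2 (Nat.le_sub_one_of_lt j.2)
  rw [norm_ohnoTerm, hlast]
  have hfac : ∀ l ∈ Finset.univ.erase (ohnoLast r),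
      (if l < j then ((l : ℕ) + 1 : ℝ) ^ (1 - (k l : ℝ)) else 1) *
        N ^ (if l < j then -1 else -(k l : ℝ)) ≤
        (n.1 l : ℝ) ^ (1 - (k l : ℝ)) * |(n.1 l : ℝ) - N|⁻¹ := fun l hl => by
    have hlt : l < ohnoLast r :=
      lt_of_le_of_ne (Fin.le_def.2 (Nat.le_sub_one_of_lt l.2)) (Finset.ne_of_mem_erase hl)
    have h0 : (0 : ℝ) < n.1 l := by exact_mod_cast n.2.1 l
    have h1 : (n.1 l : ℝ) < N := by
      rw [hN, ← hlast]
      exact_mod_cast n.2.2 hlt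
    have h2 : N⁻¹ ≤ |(n.1 l : ℝ) - N|⁻¹ := by
      rw [abs_sub_comm, abs_of_pos (sub_pos.2 h1)]
      exact inv_anti₀ (sub_pos.2 h1) (by linarith)
    have hkl : (1 : ℝ) ≤ k l := by exact_mod_cast hk l
    by_cases h : l < j
    · have : n.1 l = l + 1 := if_pos h
      rw [if_pos h, if_pos h, Real.rpow_neg_one, this]
      rw [this] at h2
      push_cast at h2 ⊢
      exact mul_le_mul_of_nonneg_left h2 (by positivity)
    · rw [if_neg h, if_neg h, one_mul,
        show -(k l : ℝ) = (1 - k l) + (-1) by ring, Real.rpow_add hN0, Real.rpow_neg_one]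
      exact mul_le_mul (Real.rpow_le_rpow_of_nonpos h0 h1.le (by linarith)) h2 (by positivity)
        (by positivity)
  have hexp : -(k (ohnoLast r) : ℝ) - s.re +
      ∑ l ∈ Finset.univ.erase (ohnoLast r), (if l < j then -1 else -(k l : ℝ)) = e := by
    have h1 : ∑ l : Fin r, (if l < j then (-1 : ℝ) else -(k l : ℝ)) =
        -(j : ℕ) - ∑ l ∈ Finset.Ici j, (k l : ℝ) := by
      have h2 : Finset.univ.filter (fun l => l < j) = Finset.Iio j := by ext; simp
      have h3 : Finset.univ.filter (fun l => ¬ l < j) = Finset.Ici j := by ext; simp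
      rw [Finset.sum_ite, h2, h3]
      simp [sub_eq_add_neg]
    rw [← Finset.add_sum_erase _ _ (Finset.mem_univ (ohnoLast r)), if_neg hj.not_gt] at h1
    linarith
  calc _ = N ^ (-(k (ohnoLast r) : ℝ) - s.re) * ∏ l ∈ Finset.univ.erase (ohnoLast r),
        ((if l < j then ((l : ℕ) + 1 : ℝ) ^ (1 - (k l : ℝ)) else 1) *
          N ^ (if l < j then -1 else -(k l : ℝ))) := by
        rw [Finset.prod_mul_distrib, ← Real.rpow_sum_of_pos hN0, mul_left_comm,
          ← Real.rpow_add hN0, hexp, hN, Nat.cast_mul, Real.mul_rpow (by positivity) hr.le]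
        ring
    _ ≤ _ := mul_le_mul_of_nonneg_left
        (Finset.prod_le_prod (fun l _ => by split_ifs <;> positivity) hfac) (by positivity)

theorem abscissa_lt_of_ohnoAbsConverges {r : ℕ} [NeZero r] {k : Fin r → ℕ} (hk : ∀ l, 1 ≤ k l)
    {s : ℂ} (hs : OhnoAbsConverges k s) : ohnoAbscissa k < s.re := by
  rw [ohnoAbscissa, Finset.sup'_lt_iff]
  intro j _
  obtain ⟨c, hc, hle⟩ := exists_le_norm_ohnoTerm hk s j
  set e := -s.re - (j : ℕ) - ∑ l ∈ Finset.Ici j, (k l : ℝ) with he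
  have h0 := (hs.prod_factor (ohnoLast r)).comp_injective (ohnoBlockTuple_injective j)
  have hnonneg : ∀ M : ℕ, 0 ≤ c * (((M + 1 : ℕ) : ℝ) ^ e) := fun M =>
    mul_nonneg hc.le (Real.rpow_nonneg (Nat.cast_nonneg _) _)
  have h1 : Summable fun x : (Σ M : ℕ, {l : Fin r // j ≤ l ∧ l < ohnoLast r} → Fin (M + 1)) =>
      c * (((x.1 + 1 : ℕ) : ℝ) ^ e) :=
    Summable.of_nonneg_of_le (fun x => hnonneg x.1) (fun x => hle x.1 x.2) h0
  have hcard : Fintype.card {l : Fin r // j ≤ l ∧ l < ohnoLast r} = r - 1 - j := by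
    rw [Fintype.card_subtype, ← Fin.card_Ico j (ohnoLast r)]
    congr 1
    ext; simp
  have hcast : ((r - 1 - j : ℕ) : ℝ) = r - 1 - (j : ℕ) := by
    have := j.2
    rw [Nat.cast_sub (by omega), Nat.cast_sub (by omega), Nat.cast_one]
  -- Each `M` carries `(M + 1) ^ (r - 1 - j)` tuples with the same lower bound.
  have h2 : Summable fun M : ℕ => c * (((M + 1 : ℕ) : ℝ) ^ (e + (r - 1 - (j : ℕ)))) := by
    refine h1.sigma.congr fun M => ?_
    rw [tsum_fintype]
    dsimp only
    rw [Finset.sum_const, Finset.card_univ, Fintype.card_fun, Fintype.card_fin,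
      hcard, nsmul_eq_mul, Nat.cast_pow, Real.rpow_add (by positivity), ← hcast,
      Real.rpow_natCast]
    ring
  have h3 := Real.summable_nat_rpow.1
    ((summable_nat_add_iff 1).1 ((summable_mul_left_iff hc.ne').1 h2))
  linarith

theorem mainTheorem1 (r : ℕ) [NeZero r] (k : Fin r → ℕ) (hk : OhnoAdmissible k) (s : ℂ) :
    OhnoAbsConverges k s ↔ ohnoAbscissa k < s.re :=
  ⟨abscissa_lt_of_ohnoAbsConverges hk.1, ohnoAbsConverges_of_abscissa_lt hk⟩
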